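/- For a prime power $q$ and integers $a, b \ge 0$ write $$\begin{bmatrix} a \\ b \end{bmatrix}_q = \prod_{i=0}^{b-1} \frac{q^{a-i}-1}{q^{b-i}-1}.$$ Let $\mathbb{F}_q$ be the finite field of order $q$, let $s \ge 1$, and let $\mathcal{L} = \{l_1, l_2, \dots, l_s\}$ be a set of $s$ integers with $0 \le l_1 < l_2 < \cdots < l_s$. Let $\mathcal{V}$ be a family (set) of subspaces of an $n$-dimensional vector space over $\mathbb{F}_q$ such that no member of $\mathcal{V}$ is contained in another member (that is, $\mathcal{V}$ is Sperner) and $\dim(V_i \cap V_j) \in \mathcal{L}$ for any two distinct members $V_i, V_j$ of $\mathcal{V}$. Let $k = \max_{V \in \mathcal{V}} \dim V$ (with $k = 0$ if $\mathcal{V}$ is empty). If $$n \ge \max\left\{ \log_q\left( (q^s - 1) \begin{bmatrix} k^2 \\ l_1 + 1 \end{bmatrix}_q + 1 \right) + l_1,\; 2s + 1 \right\},$$ then $$|\mathcal{V}| \le \begin{bmatrix} n \\ s \end{bmatrix}_q.$$ Moreover, if $|\mathcal{V}| = \begin{bmatrix} n \\ s \end{bmatrix}_q$, then $\mathcal{L}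 = \{0, 1, \dots, s-1\}$. -/

import Mathlib

/-- The Gaussian binomial coefficient `∏_{0 ≤ i ≤ k - 1} (q^(n - i) - 1) / (q^(k - i) - 1)`.
In the denominators `i < k`, so `k - i` is a true difference. If `n < k`, the factor with
`i = n` is zero, hence so is the product (as with untruncated exponents); if `k = 0`, the
product is empty and equal to `1`. -/
noncomputable def gaussBinom (q : ℝ) (n k : ℕ) : ℝ :=
  ∏ i ∈ Finset.range k, (q ^ (n - i) - 1) / (q ^ (k - i) - 1)

/-- The largest dimension of a member of a finite family of subspaces
(with the convention that it is `0` for the empty family). -/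
noncomputable def maxDim {F W : Type*} [Field F] [AddCommGroup W] [Module F W]
    (V : Finset (Submodule F W)) : ℕ :=
  V.sup fun U => Module.finrank F U

/-! ### Estimates for Gaussian binomials. -/

section GaussBinom

open Finset

/-! Write `[n, s]` for the Gaussian binomial and `l` for `min L`. The engine is a Frankl–Wilson
bound by the polynomial method (`card_le_card_grassmannLE`): an antichain with `s` intersection
dimensions has at most `∑ i ≤ s, [n, i]` members. This exceeds `[n, s]`, so the proof arranges to
apply it with one dimension fewer: for `2 * s + 1 ≤ n` the sum over `i < s` is at most `[n, s] / 3`.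

The logarithmic hypothesis enters only through `l + s + (l + 1) * (k ^ 2 - (l + 1)) ≤ n`.

If `l = 0` and `L = {0, ..., s - 1}`, double counting against the `s`-dimensional subspaces gives
`[n, s]`. If `l = 0` and `L` is another set, members of dimension at most `s` miss some intersection
dimension, and so do members through a fixed nonzero vector; averaging over vectors gives a strict
bound (`card_lt_gaussBinom_of_ne_range`).

If `l > 0`, either all members share an `l`-dimensional subspace, and splitting it off reduces to `l
= 0` in dimension `n - l`, or the members fall into at most `q ^ (2 * l * k)` classes on which `l`
is not an intersection dimension. Both bounds are strict, so equality forces `L = {0, ..., s - 1}`.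
-/

lemma gaussBinom_eq_prod_div (q : ℝ) (n k : ℕ) :
    gaussBinom q n k = ∏ j ∈ range k, (q ^ (n - j) - 1) / (q ^ (j + 1) - 1) := by
  unfold gaussBinom
  rw [prod_div_distrib, prod_div_distrib]
  congr 1
  rw [← prod_range_reflect]
  refine prod_congr rfl fun j hj => ?_
  have := mem_range.1 hj
  rw [show k - (k - 1 - j) = j + 1 by omega]

@[simp] lemma gaussBinom_zero_right (q : ℝ) (n : ℕ) : gaussBinom q n 0 = 1 := by
  simp [gaussBinom]

lemma gaussBinom_succ_right (q : ℝ) (n k : ℕ) :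
    gaussBinom q n (k + 1) = gaussBinom q n k * ((q ^ (n - k) - 1) / (q ^ (k + 1) - 1)) := by
  simp only [gaussBinom_eq_prod_div, prod_range_succ]

lemma gaussBinom_succ_succ (q : ℝ) (n k : ℕ) :
    gaussBinom q (n + 1) (k + 1) = gaussBinom q n k * ((q ^ (n + 1) - 1) / (q ^ (k + 1) - 1)) := by
  simp [gaussBinom, prod_range_succ', -prod_div_distrib]

variable {q : ℝ}

lemma pow_sub_one_pos (hq : 2 ≤ q) {m : ℕ} (hm : m ≠ 0) : 0 < q ^ m - 1 :=
  sub_pos.2 (one_lt_pow₀ (by linarith) hm)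

lemma gaussBinom_pos (hq : 2 ≤ q) {n k : ℕ} (h : k ≤ n) : 0 < gaussBinom q n k := by
  refine prod_pos fun i hi => ?_
  have := mem_range.1 hi
  exact div_pos (pow_sub_one_pos hq (by omega)) (pow_sub_one_pos hq (by omega))

/-- The ratio `(q ^ (n - i) - 1) / (q ^ (i + 1) - 1)` is at least `q ^ 2`. Hence the sum in the next
lemma is dominated by the series `1/4 + 1/16 + ... = 1/3`. -/
lemma four_mul_gaussBinom_le (hq : 2 ≤ q) {n i : ℕ} (h : 2 * i + 3 ≤ n) :
    4 * gaussBinom q n i ≤ gaussBinom q n (i + 1) := by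
  rw [gaussBinom_succ_right, mul_comm]
  refine mul_le_mul_of_nonneg_left ?_ (gaussBinom_pos hq (by omega)).le
  rw [le_div_iff₀ (pow_sub_one_pos hq (by omega))]
  have h1 : q ^ (i + 1 + 2) ≤ q ^ (n - i) := pow_le_pow_right₀ (by linarith) (by omega)
  have h2 : 0 < q ^ (i + 1) := by positivity
  rw [pow_add] at h1
  have h3 : q ^ (i + 1) * 4 ≤ q ^ (i + 1) * q ^ 2 :=
    mul_le_mul_of_nonneg_left (by nlinarith) h2.le
  linarith

lemma three_mul_sum_gaussBinom_le (hq : 2 ≤ q) {n s : ℕ} (h : 2 * s + 1 ≤ n) :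
    3 * ∑ i ∈ range s, gaussBinom q n i ≤ gaussBinom q n s := by
  induction s with
  | zero => simp
  | succ s ih =>
    have h1 := ih (by omega)
    have h2 := four_mul_gaussBinom_le hq (n := n) (i := s) (by omega)
    rw [sum_range_succ]
    linarith

lemma gaussBinom_lt_gaussBinom_of_lt_right (hq : 2 ≤ q) {n s t : ℕ} (hst : s < t)
    (h : 2 * t + 1 ≤ n) : gaussBinom q n s < gaussBinom q n t := by
  have h1 := three_mul_sum_gaussBinom_le hq h
  have h2 : gaussBinom q n s ≤ ∑ i ∈ range t, gaussBinom q n i :=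
    single_le_sum (f := fun i => gaussBinom q n i)
      (fun i hi => (gaussBinom_pos hq (by have := mem_range.1 hi; omega)).le) (mem_range.2 hst)
  have h3 := gaussBinom_pos hq (n := n) (k := s) (by omega)
  linarith

lemma gaussBinom_lt_gaussBinom_of_lt_left (hq : 2 ≤ q) {m n s : ℕ} (hs : s ≠ 0) (hsm : s ≤ m)
    (hmn : m < n) : gaussBinom q m s < gaussBinom q n s := by
  refine prod_lt_prod_of_nonempty (fun i hi => ?_) (fun i hi => ?_) (by simpa using hs)
  · have := mem_range.1 hi
    exact div_pos (pow_sub_one_pos hq (by omega)) (pow_sub_one_pos hq (by omega))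
  · have := mem_range.1 hi
    refine div_lt_div_of_pos_right ?_ (pow_sub_one_pos hq (by omega))
    have : q ^ (m - i) < q ^ (n - i) := pow_lt_pow_right₀ (by linarith) (by omega)
    linarith

/-- Each of the `b` factors is at least `q ^ (a - b)`. -/
lemma pow_le_gaussBinom (hq : 2 ≤ q) {a b : ℕ} (h : b ≤ a) :
    q ^ (b * (a - b)) ≤ gaussBinom q a b := by
  have : q ^ (b * (a - b)) = ∏ _i ∈ range b, q ^ (a - b) := by
    rw [prod_const, card_range, ← pow_mul, mul_comm]
  rw [this]
  refine prod_le_prod (fun i _ => by positivity) fun i hi => ?_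
  have hi := mem_range.1 hi
  rw [le_div_iff₀ (pow_sub_one_pos hq (by omega)), mul_sub, ← pow_add,
    show a - b + (b - i) = a - i by omega]
  have : 1 ≤ q ^ (a - b) := one_le_pow₀ (by linarith)
  linarith

lemma mul_sum_gaussBinom_lt (hq : 2 ≤ q) {n s e : ℕ} (h : 2 * s + 3 ≤ n)
    (he : e + 1 + (2 * s + 1) ≤ n) :
    q ^ e * ∑ i ∈ range (s + 1), gaussBinom q n i < gaussBinom q n (s + 1) := by
  have h1 := three_mul_sum_gaussBinom_le hq (n := n) (s := s) (by omega)
  have h0 := gaussBinom_pos hq (n := n) (k := s) (by omega)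
  have h2 : ∑ i ∈ range (s + 1), gaussBinom q n i < 2 * gaussBinom q n s := by
    rw [sum_range_succ]; linarith
  have h3 : 2 * q ^ e ≤ (q ^ (n - s) - 1) / (q ^ (s + 1) - 1) := by
    rw [le_div_iff₀ (pow_sub_one_pos hq (by omega))]
    have h4 : q ^ (e + 1 + (s + 1)) ≤ q ^ (n - s) :=
      pow_le_pow_right₀ (by linarith) (by omega)
    have h5 : 2 * q ^ e ≤ q ^ (e + 1) := by
      rw [pow_succ, mul_comm]
      exact mul_le_mul_of_nonneg_left hq (by positivity)
    have h6 : 1 ≤ q ^ e := one_le_pow₀ (by linarith)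
    rw [pow_add] at h4
    have h7 : 0 < q ^ (s + 1) := by positivity
    nlinarith [mul_le_mul_of_nonneg_right h5 h7.le]
  rw [gaussBinom_succ_right]
  calc q ^ e * ∑ i ∈ range (s + 1), gaussBinom q n i
      < q ^ e * (2 * gaussBinom q n s) := mul_lt_mul_of_pos_left h2 (by positivity)
    _ = gaussBinom q n s * (2 * q ^ e) := by ring
    _ ≤ _ := mul_le_mul_of_nonneg_left h3 h0.le

/-- Trades the logarithmic hypothesis for an inequality between natural numbers, using `q ^ (s - 1)
≤ q ^ s - 1`; the `+ 1` inside the logarithm makes the comparison of powers strict, which turns `s -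
1` into `s`. -/
lemma le_of_logb_gaussBinom_le (hq : 2 ≤ q) {n s l m : ℕ} (hs : s ≠ 0) (hlm : l + 1 ≤ m)
    (h : Real.logb q ((q ^ s - 1) * gaussBinom q m (l + 1) + 1) + l ≤ n) :
    l + s + (l + 1) * (m - (l + 1)) ≤ n := by
  set X := (q ^ s - 1) * gaussBinom q m (l + 1) + 1 with hX
  have hpos := mul_pos (pow_sub_one_pos hq hs) (gaussBinom_pos hq hlm)
  have hX1 : 1 ≤ X := by linarith
  have hlog : 0 ≤ Real.logb q X := Real.logb_nonneg (by linarith) hX1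
  have hln : l ≤ n := by
    have : (l : ℝ) ≤ n := by linarith
    exact_mod_cast this
  have hle : X ≤ q ^ (n - l) := by
    rw [← Real.rpow_natCast, Nat.cast_sub hln]
    rw [← Real.logb_le_iff_le_rpow (by linarith) (by linarith)]
    linarith
  obtain ⟨t, rfl⟩ : ∃ t, s = t + 1 := ⟨s - 1, by omega⟩
  have h1 : q ^ t ≤ q ^ (t + 1) - 1 := by
    have : 1 ≤ q ^ t := one_le_pow₀ (by linarith)
    rw [pow_succ]; nlinarith
  have h2 := pow_le_gaussBinom hq hlm
  have h3 : q ^ (t + (l + 1) * (m - (l + 1))) < q ^ (n - l) := by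
    rw [pow_add]
    have : q ^ t * q ^ ((l + 1) * (m - (l + 1))) ≤ (q ^ (t + 1) - 1) * gaussBinom q m (l + 1) :=
      mul_le_mul h1 h2 (by positivity) (pow_sub_one_pos hq hs).le
    linarith
  have h4 := (pow_lt_pow_iff_right₀ (by linarith : 1 < q)).1 h3
  omega

end GaussBinom

/-! ### Counting subspaces of a finite vector space. -/

section Counting

set_option linter.unusedSectionVars false

open Finset Module

variable {F W : Type*} [Field F] [Fintype F] [AddCommGroup W] [Module F W] [Finite W]

variable (F W) in
/-- The `i`-dimensional subspaces of a finite vector space. -/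
noncomputable def grassmann (i : ℕ) : Finset (Submodule F W) :=
  (Set.toFinite {T : Submodule F W | finrank F T = i}).toFinset

@[simp] lemma mem_grassmann {i : ℕ} {T : Submodule F W} :
    T ∈ grassmann F W i ↔ finrank F T = i := by
  simp [grassmann]

/-- A linearly independent tuple is a linearly independent tuple in its span. -/
noncomputable def linearIndependentEquivSigma (k : ℕ) :
    {s : Fin k → W // LinearIndependent F s} ≃
      Σ T : grassmann F W k, {s : Fin k → T.1 // LinearIndependent F s} where
  toFun s := ⟨⟨Submodule.span F (Set.range s.1), by
      simpa using finrank_span_eq_card s.2⟩,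
    ⟨fun i => ⟨s.1 i, Submodule.subset_span ⟨i, rfl⟩⟩, by
      exact linearIndependent_span s.2⟩⟩
  invFun x := ⟨fun i => (x.2.1 i : W), x.2.2.map' _ (Submodule.ker_subtype _)⟩
  left_inv s := rfl
  right_inv := by
    rintro ⟨⟨T, hT⟩, ⟨s, hs⟩⟩
    have hli : LinearIndependent F fun i => (s i : W) := hs.map' _ (Submodule.ker_subtype _)
    have hspan : Submodule.span F (Set.range fun i => (s i : W)) = T := by
      apply Submodule.eq_of_le_of_finrank_eq
      · rw [Submodule.span_le]
        rintro _ ⟨i, rfl⟩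
        exact (s i).2
      · rw [finrank_span_eq_card hli, mem_grassmann.1 hT, Fintype.card_fin]
    -- The tuple's type depends on the subspace, so the span is generalized to a variable `S` that
    -- can be substituted.
    have key : ∀ (S : Submodule F W) (hS : S ∈ grassmann F W k) (_ : S = T) (t : Fin k → S)
        (ht : LinearIndependent F t), (∀ i, (t i : W) = s i) →
        (⟨⟨S, hS⟩, ⟨t, ht⟩⟩ : Σ T : grassmann F W k, {s : Fin k → T.1 // LinearIndependent F s}) =
          ⟨⟨T, hT⟩, ⟨s, hs⟩⟩ := by
      rintro S hS rfl t ht h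
      obtain rfl : t = s := funext fun i => Subtype.ext (h i)
      rfl
    exact key _ _ hspan _ _ fun _ => rfl

lemma card_grassmann_mul {k : ℕ} (hk : k ≤ finrank F W) :
    #(grassmann F W k) * ∏ i : Fin k, (Fintype.card F ^ k - Fintype.card F ^ (i : ℕ)) =
      ∏ i : Fin k, (Fintype.card F ^ finrank F W - Fintype.card F ^ (i : ℕ)) := by
  rw [← card_linearIndependent hk, Nat.card_congr (linearIndependentEquivSigma k), Nat.card_sigma]
  have h : ∀ T : grassmann F W k, Nat.card {s : Fin k → T.1 // LinearIndependent F s} =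
      ∏ i : Fin k, (Fintype.card F ^ k - Fintype.card F ^ (i : ℕ)) := fun T => by
    have hT := mem_grassmann.1 T.2
    rw [card_linearIndependent hT.ge, hT]
  simp [h]

lemma two_le_card_field : (2 : ℝ) ≤ Fintype.card F := by
  exact_mod_cast Fintype.one_lt_card

/-- The Gaussian binomial coefficient counts subspaces. -/
lemma card_grassmann {k : ℕ} (hk : k ≤ finrank F W) :
    (#(grassmann F W k) : ℝ) = gaussBinom (Fintype.card F) (finrank F W) k := by
  have h := card_grassmann_mul (F := F) (W := W) hk
  set q := Fintype.card F
  set n := finrank F W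
  have hq : (2 : ℝ) ≤ q := two_le_card_field
  have hq1 : 1 ≤ q := Fintype.card_pos
  have key : ∀ m, k ≤ m → ((∏ i : Fin k, (q ^ m - q ^ (i : ℕ)) : ℕ) : ℝ) =
      (∏ i ∈ range k, (q : ℝ) ^ i) * ∏ i ∈ range k, ((q : ℝ) ^ (m - i) - 1) := by
    intro m hm
    rw [Fin.prod_univ_eq_prod_range (fun i => q ^ m - q ^ i), ← prod_mul_distrib, Nat.cast_prod]
    refine prod_congr rfl fun i hi => ?_
    have hi := mem_range.1 hi
    rw [Nat.cast_sub (Nat.pow_le_pow_right hq1 (by omega)), mul_sub, ← pow_add,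
      show i + (m - i) = m by omega]
    simp
  have h' := congrArg (Nat.cast (R := ℝ)) h
  rw [Nat.cast_mul, key k le_rfl, key n hk] at h'
  have hp : (0 : ℝ) < ∏ i ∈ range k, (q : ℝ) ^ i := prod_pos fun i _ => by positivity
  have hp' : (0 : ℝ) < ∏ i ∈ range k, ((q : ℝ) ^ (k - i) - 1) := prod_pos fun i hi =>
    pow_sub_one_pos hq (by have := mem_range.1 hi; omega)
  rw [gaussBinom, prod_div_distrib, eq_div_iff hp'.ne']
  apply mul_left_cancel₀ hp.ne'
  linarith

variable (F W) in
/-- The subspaces of dimension at most `m`. -/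
noncomputable def grassmannLE (m : ℕ) : Finset (Submodule F W) :=
  (Set.toFinite {T : Submodule F W | finrank F T ≤ m}).toFinset

@[simp] lemma mem_grassmannLE {m : ℕ} {T : Submodule F W} :
    T ∈ grassmannLE F W m ↔ finrank F T ≤ m := by
  simp [grassmannLE]

lemma card_grassmannLE {m : ℕ} (hm : m ≤ finrank F W) :
    (#(grassmannLE F W m) : ℝ) =
      ∑ i ∈ range (m + 1), gaussBinom (Fintype.card F) (finrank F W) i := by
  classical
  rw [card_eq_sum_card_fiberwise (f := fun T : Submodule F W => finrank F T) (t := range (m + 1))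
    (fun T hT => by simpa [Nat.lt_succ_iff] using hT), Nat.cast_sum]
  refine sum_congr rfl fun i hi => ?_
  have hi := mem_range.1 hi
  rw [← card_grassmann (by omega)]
  congr 2
  ext T
  simp only [mem_filter, mem_grassmannLE, mem_grassmann]
  omega

lemma exists_le_finrank_eq (U : Submodule F W) {m : ℕ} (h : m ≤ finrank F U) :
    ∃ T ≤ U, finrank F T = m := by
  obtain ⟨f, hf⟩ := exists_linearIndependent_of_le_finrank h
  refine ⟨(Submodule.span F (Set.range f)).map U.subtype, Submodule.map_subtype_le _ _, ?_⟩
  rw [Submodule.finrank_map_subtype_eq, finrank_span_eq_card hf, Fintype.card_fin]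

lemma exists_ge_finrank_eq (U : Submodule F W) {m : ℕ} (h : finrank F U ≤ m)
    (hm : m ≤ finrank F W) : ∃ T ≥ U, finrank F T = m := by
  obtain ⟨C, hC⟩ := U.exists_isCompl
  have h1 := Submodule.finrank_add_eq_of_isCompl hC
  obtain ⟨D, hD, hDm⟩ := exists_le_finrank_eq C (m := m - finrank F U) (by omega)
  refine ⟨U ⊔ D, le_sup_left, ?_⟩
  have h2 := Submodule.finrank_sup_add_finrank_inf_eq U D
  rw [(hC.disjoint.mono_right hD).eq_bot, finrank_bot] at h2
  omega

lemma exists_fun_span_range_eq (U : Submodule F W) {m : ℕ} (h : finrank F U ≤ m) :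
    ∃ f : Fin m → U, (Submodule.span F (Set.range fun i => (f i : W))) = U := by
  have b := finBasis F U
  -- A basis padded with zeros to length `m`.
  refine ⟨fun i => if hi : (i : ℕ) < finrank F U then b ⟨i, hi⟩ else 0, le_antisymm ?_ ?_⟩
  · rw [Submodule.span_le]
    rintro _ ⟨i, rfl⟩
    exact Subtype.prop _
  · have h1 : U = Submodule.span F (Set.range fun i => (b i : W)) := by
      have := congrArg (Submodule.map U.subtype) b.span_eq
      rw [Submodule.map_span, ← Set.range_comp, Submodule.map_subtype_top] at this
      exact this.symm
    conv_lhs => rw [h1]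
    apply Submodule.span_mono
    rintro _ ⟨i, rfl⟩
    exact ⟨⟨i, by omega⟩, by simp⟩

/-- A crude bound for the number of subspaces of `M` of dimension at most `m`. -/
lemma card_subspaces_le_pow (M : Submodule F W) (m : ℕ) (S : Finset (Submodule F W))
    (hS : ∀ U ∈ S, U ≤ M ∧ finrank F U ≤ m) : #S ≤ Fintype.card F ^ (finrank F M * m) := by
  classical
  have : ∀ U : S, ∃ f : Fin m → M, Submodule.span F (Set.range fun i => (f i : W)) = U := by
    intro U
    obtain ⟨f, hf⟩ := exists_fun_span_range_eq U.1 (hS U U.2).2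
    exact ⟨fun i => ⟨f i, (hS U U.2).1 (f i).2⟩, hf⟩
  choose f hf using this
  have hinj : Function.Injective f := fun U₁ U₂ h => by
    apply Subtype.ext
    rw [← hf U₁, ← hf U₂, h]
  have := Fintype.ofFinite M
  have h1 := Fintype.card_le_of_injective f hinj
  rwa [Fintype.card_coe, Fintype.card_fun, Fintype.card_fin, card_eq_pow_finrank (K := F),
    ← pow_mul] at h1

/-- A proper subspace `U` lies in many subspaces of each larger dimension `s`. -/
lemma pow_le_card_grassmann_above (U : Submodule F W) {s : ℕ} (hU : finrank F U < s)
    (hs : s ≤ finrank F W) (S : Finset (Submodule F W))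
    (hS : ∀ T, U ≤ T → finrank F T = s → T ∈ S) :
    Fintype.card F ^ (finrank F W - s) ≤ #S := by
  classical
  have := Fintype.ofFinite W
  obtain ⟨U', hUU', hU'⟩ := exists_ge_finrank_eq U (m := s - 1) (by omega) (by omega)
  set q := Fintype.card F with hq
  have hq1 : 1 < q := Fintype.one_lt_card
  set A : Finset W := univ.filter fun v => v ∉ U' with hA
  have hcard : ∀ T : Submodule F W, #(univ.filter fun v => v ∈ T) = q ^ finrank F T := by
    intro T
    rw [← Fintype.card_subtype, card_eq_pow_finrank (K := F)]
  have hAcard : #A + q ^ (s - 1) = q ^ finrank F W := by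
    rw [← hU', ← hcard, add_comm, hA, card_filter_add_card_filter_not, card_univ,
      card_eq_pow_finrank (K := F)]
  -- The map `v ↦ U' ⊔ span {v}` sends vectors outside the `(s - 1)`-dimensional `U'` into `S`; a
  -- fibre lies in its image subspace, so has at most `q ^ s` elements.
  have hle : #A ≤ q ^ s * #S := by
    have hfin : ∀ v ∈ A, finrank F (U' ⊔ Submodule.span F {v} : Submodule F W) = s := by
      intro v hv
      have hv : v ∉ U' := by simpa [hA] using hv
      have h1 := Submodule.finrank_sup_add_finrank_inf_eq U' (Submodule.span F {v})
      have hv0 : v ≠ 0 := fun h => hv (h ▸ U'.zero_mem)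
      rw [finrank_span_singleton hv0] at h1
      have h2 : U' < U' ⊔ Submodule.span F {v} := by
        refine lt_of_le_of_ne le_sup_left fun h => hv ?_
        rw [h]
        exact Submodule.mem_sup_right (Submodule.mem_span_singleton_self v)
      have h3 := Submodule.finrank_lt_finrank_of_lt h2
      omega
    refine card_le_mul_card_image_of_maps_to (f := fun v => U' ⊔ Submodule.span F {v})
      (fun v hv => hS _ (hUU'.trans le_sup_left) (hfin v hv)) _ fun T _ => ?_
    by_cases hT : ∃ v ∈ A, U' ⊔ Submodule.span F {v} = T
    · obtain ⟨w, hw, rfl⟩ := hT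
      rw [← hfin w hw, ← hcard]
      refine card_le_card fun v hv => ?_
      simp only [mem_filter, mem_univ, true_and] at hv ⊢
      rw [← hv.2]
      exact Submodule.mem_sup_right (Submodule.mem_span_singleton_self v)
    · rw [filter_eq_empty_iff.2 fun v hv h => hT ⟨v, hv, h⟩]
      simp
  have h1 : q ^ finrank F W = q ^ s * q ^ (finrank F W - s) := by
    rw [← pow_add, Nat.add_sub_cancel' hs]
  have h2 : q ^ (s - 1) < q ^ s := Nat.pow_lt_pow_right hq1 (by omega)
  by_contra! hlt
  have h3 : q ^ s * (#S + 1) ≤ q ^ s * q ^ (finrank F W - s) := Nat.mul_le_mul_left _ hlt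
  rw [mul_add, mul_one] at h3
  omega

end Counting

/-! ### The polynomial method and splitting off a common subspace. -/

section PolynomialMethod

set_option linter.unusedSectionVars false

open Finset Module

variable {F W : Type*} [Field F] [Fintype F] [AddCommGroup W] [Module F W] [Finite W]

open Classical in
/-- The indicator of the subspaces containing `T`. -/
noncomputable def aboveIndicator (T : Submodule F W) : Submodule F W → ℚ :=
  fun U => if T ≤ U then 1 else 0

/-- Indicators behave like monomials with dimension as degree: a factor coming from a line raises
the degree by at most one. -/
lemma aboveIndicator_mul (S T : Submodule F W) :
    aboveIndicator S * aboveIndicator T = aboveIndicator (S ⊔ T) := by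
  ext U
  simp only [aboveIndicator, Pi.mul_apply, sup_le_iff]
  split_ifs <;> simp_all

variable (F W) in
/-- The functions on subspaces spanned by the indicators of subspaces of dimension at most `m`. -/
noncomputable def lowDegree (m : ℕ) : Submodule ℚ (Submodule F W → ℚ) :=
  Submodule.span ℚ (aboveIndicator '' (grassmannLE F W m : Set (Submodule F W)))

lemma lowDegree_mono {m m' : ℕ} (h : m ≤ m') : lowDegree F W m ≤ lowDegree F W m' := by
  refine Submodule.span_mono (Set.image_mono fun T hT => ?_)
  simp only [mem_coe, mem_grassmannLE] at hT ⊢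
  omega

lemma finrank_lowDegree_le (m : ℕ) : finrank ℚ (lowDegree F W m) ≤ #(grassmannLE F W m) := by
  classical
  rw [lowDegree, ← coe_image]
  exact (finrank_span_finset_le_card _).trans card_image_le

lemma aboveIndicator_span_singleton_mul_mem {m : ℕ} (v : W) {f : Submodule F W → ℚ}
    (hf : f ∈ lowDegree F W m) :
    aboveIndicator (Submodule.span F {v}) * f ∈ lowDegree F W (m + 1) := by
  have : lowDegree F W m ≤ (lowDegree F W (m + 1)).comap
      (LinearMap.mulLeft ℚ (aboveIndicator (Submodule.span F {v}))) := by
    rw [lowDegree, Submodule.span_le]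
    rintro _ ⟨T, hT, rfl⟩
    simp only [mem_coe, mem_grassmannLE] at hT
    simp only [Submodule.comap_coe, Set.mem_preimage, LinearMap.mulLeft_apply, SetLike.mem_coe]
    rw [aboveIndicator_mul]
    refine Submodule.subset_span ⟨_, ?_, rfl⟩
    simp only [mem_coe, mem_grassmannLE]
    have h1 := Submodule.finrank_sup_add_finrank_inf_eq (Submodule.span F {v}) T
    have h2 : finrank F (Submodule.span F {v}) ≤ 1 := by
      simpa using finrank_span_le_card (R := F) ({v} : Set W)
    omega
  exact this hf

/-- Both sides count the vectors of `A ⊓ U`; thus the left side, as a function of `U`, has degree at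
most one. -/
lemma pow_finrank_inf_eq_sum [Fintype W] (A U : Submodule F W) [DecidablePred (· ∈ A)] :
    (Fintype.card F : ℚ) ^ finrank F (A ⊓ U : Submodule F W) =
      ∑ v : W with v ∈ A, aboveIndicator (Submodule.span F {v}) U := by
  classical
  simp only [aboveIndicator, Submodule.span_singleton_le_iff_mem]
  rw [sum_boole, filter_filter, ← Nat.cast_pow, ← card_eq_pow_finrank, Fintype.card_subtype]
  simp only [Submodule.mem_inf]

lemma prod_pow_finrank_inf_sub_mem (A : Submodule F W) (c : ℕ → ℚ) (S : Finset ℕ) :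
    (fun U => ∏ l ∈ S, ((Fintype.card F : ℚ) ^ finrank F (A ⊓ U : Submodule F W) - c l)) ∈
      lowDegree F W #S := by
  classical
  have := Fintype.ofFinite W
  induction S using Finset.induction_on with
  | empty =>
    refine Submodule.subset_span ⟨⊥, by simp, ?_⟩
    ext U
    simp [aboveIndicator]
  | insert a S ha ih =>
    rw [card_insert_of_notMem ha]
    have : (fun U => ∏ l ∈ insert a S,
          ((Fintype.card F : ℚ) ^ finrank F (A ⊓ U : Submodule F W) - c l)) =
        (∑ v : W with v ∈ A, aboveIndicator (Submodule.span F {v}) *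
          fun U => ∏ l ∈ S, ((Fintype.card F : ℚ) ^ finrank F (A ⊓ U : Submodule F W) - c l)) -
        c a • fun U => ∏ l ∈ S,
          ((Fintype.card F : ℚ) ^ finrank F (A ⊓ U : Submodule F W) - c l) := by
      ext U
      simp only [Pi.sub_apply, Finset.sum_apply, Pi.mul_apply, Pi.smul_apply, smul_eq_mul]
      rw [prod_insert ha, ← sum_mul, ← pow_finrank_inf_eq_sum, sub_mul]
    rw [this]
    exact sub_mem (sum_mem fun v _ => aboveIndicator_span_singleton_mul_mem v ih)
      (Submodule.smul_mem _ _ (lowDegree_mono (Nat.le_succ _) ih))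

/-- A Frankl–Wilson type bound for antichains of subspaces with few intersection dimensions. -/
theorem card_le_card_grassmannLE (V : Finset (Submodule F W)) (L : Finset ℕ)
    (hV : IsAntichain (· ≤ ·) (V : Set (Submodule F W)))
    (hL : ∀ U₁ ∈ V, ∀ U₂ ∈ V, U₁ ≠ U₂ → finrank F (U₁ ⊓ U₂ : Submodule F W) ∈ L) :
    #V ≤ #(grassmannLE F W #L) := by
  classical
  refine le_trans ?_ (finrank_lowDegree_le #L)
  set q := Fintype.card F
  have hq : 1 < q := Fintype.one_lt_card
  -- Keeping only `l < finrank A` makes `f A` nonzero at `A`. It still vanishes at the other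
  -- members, which meet `A` in smaller dimension by the antichain property. So the `f A` are
  -- independent.
  let S : Submodule F W → Finset ℕ := fun A => {l ∈ L | l < finrank F A}
  let f : V → lowDegree F W #L := fun A =>
    ⟨fun U => ∏ l ∈ S A, ((q : ℚ) ^ finrank F (A.1 ⊓ U : Submodule F W) - (q : ℚ) ^ l),
      lowDegree_mono (card_le_card (filter_subset _ _)) (prod_pow_finrank_inf_sub_mem _ _ _)⟩
  have hself : ∀ A : V, (f A).1 A ≠ 0 := fun A => by
    refine prod_ne_zero_iff.2 fun l hl => sub_ne_zero.2 ?_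
    rw [inf_idem]
    have hl := (mem_filter.1 hl).2
    exact (pow_lt_pow_right₀ (by exact_mod_cast hq) hl).ne'
  have hother : ∀ A B : V, A ≠ B → (f A).1 B = 0 := fun A B hAB => by
    have hne : A.1 ≠ B.1 := fun h => hAB (Subtype.ext h)
    refine prod_eq_zero (i := finrank F (A.1 ⊓ B.1 : Submodule F W))
      (mem_filter.2 ⟨hL A A.2 B B.2 hne, ?_⟩) (sub_self _)
    refine Submodule.finrank_lt_finrank_of_lt (lt_of_le_of_ne inf_le_left fun h => ?_)
    exact hV A.2 B.2 hne (inf_eq_left.1 h)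
  have hli : LinearIndependent ℚ f := by
    rw [Fintype.linearIndependent_iff]
    intro g hg A
    have h := congrFun (congrArg Subtype.val hg) A.1
    simp only [Submodule.coe_sum, Submodule.coe_smul, Finset.sum_apply, Pi.smul_apply,
      smul_eq_mul, ZeroMemClass.coe_zero, Pi.zero_apply] at h
    rw [Fintype.sum_eq_single A fun B hB => by rw [hother B A hB, mul_zero]] at h
    exact (mul_eq_zero.1 h).resolve_right (hself A)
  simpa using hli.fintype_card_le_finrank

/-- A family of subspaces all containing `T` has the intersection pattern, shifted by `finrank T`,
of a family of subspaces of a complement of `T`. -/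
lemma exists_family_in_complement (T : Submodule F W) (V : Finset (Submodule F W)) (L : Finset ℕ)
    (hT : ∀ U ∈ V, T ≤ U) (hV : IsAntichain (· ≤ ·) (V : Set (Submodule F W)))
    (hL : ∀ U₁ ∈ V, ∀ U₂ ∈ V, U₁ ≠ U₂ → finrank F (U₁ ⊓ U₂ : Submodule F W) ∈ L) :
    ∃ C : Submodule F W, finrank F T + finrank F C = finrank F W ∧
      ∃ V' : Finset (Submodule F C), #V' = #V ∧
        IsAntichain (· ≤ ·) (V' : Set (Submodule F C)) ∧
        ∀ U₁ ∈ V', ∀ U₂ ∈ V', U₁ ≠ U₂ →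
          finrank F (U₁ ⊓ U₂ : Submodule F C) ∈ L.image (· - finrank F T) := by
  classical
  obtain ⟨C, hC⟩ := T.exists_isCompl
  refine ⟨C, Submodule.finrank_add_eq_of_isCompl hC,
    V.image (Submodule.comap C.subtype), ?_, ?_, ?_⟩
  all_goals
    -- By the modular law a member is recovered from its trace on `C` as `T ⊔ C ⊓ U`.
    have hle : ∀ U₁ ∈ V, ∀ U₂ ∈ V, U₁.comap C.subtype ≤ U₂.comap C.subtype → U₁ ≤ U₂ := by
      intro U₁ h₁ U₂ h₂ h
      have h3 := Submodule.map_mono (f := C.subtype) h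
      rw [Submodule.map_comap_subtype, Submodule.map_comap_subtype] at h3
      have h4 : U₁ = T ⊔ C ⊓ U₁ := by
        rw [← sup_inf_assoc_of_le C (hT U₁ h₁), hC.sup_eq_top, top_inf_eq]
      rw [h4]
      exact sup_le (hT U₂ h₂) (h3.trans inf_le_right)
  · refine card_image_of_injOn fun U₁ h₁ U₂ h₂ h => ?_
    exact le_antisymm (hle U₁ h₁ U₂ h₂ h.le) (hle U₂ h₂ U₁ h₁ h.ge)
  · rw [coe_image]
    rintro _ ⟨U₁, h₁, rfl⟩ _ ⟨U₂, h₂, rfl⟩ hne h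
    exact hV h₁ h₂ (fun h => hne (by rw [h])) (hle U₁ h₁ U₂ h₂ h)
  · intro X₁ hX₁ X₂ hX₂ hne
    obtain ⟨U₁, h₁, rfl⟩ := mem_image.1 hX₁
    obtain ⟨U₂, h₂, rfl⟩ := mem_image.1 hX₂
    refine mem_image.2 ⟨_, hL U₁ h₁ U₂ h₂ fun h => hne (by rw [h]), ?_⟩
    rw [← Submodule.comap_inf, ← Submodule.finrank_map_subtype_eq, Submodule.map_comap_subtype]
    have h5 : T ≤ U₁ ⊓ U₂ := le_inf (hT _ h₁) (hT _ h₂)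
    have h6 := Submodule.finrank_sup_add_finrank_inf_eq T (C ⊓ (U₁ ⊓ U₂))
    rw [← sup_inf_assoc_of_le C h5, hC.sup_eq_top, top_inf_eq,
      (hC.disjoint.mono_right inf_le_left).eq_bot, finrank_bot] at h6
    omega

end PolynomialMethod

/-! ### Bounds for antichains with prescribed intersection dimensions. -/

section IntersectingAntichains

set_option linter.unusedSectionVars false

open Finset Module

variable {F W : Type*} [Field F] [Fintype F] [AddCommGroup W] [Module F W] [Finite W]

lemma finrank_inf_lt_of_antichain {V : Finset (Submodule F W)}
    (hV : IsAntichain (· ≤ ·) (V : Set (Submodule F W))) {U₁ U₂ : Submodule F W}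
    (h₁ : U₁ ∈ V) (h₂ : U₂ ∈ V) (hne : U₁ ≠ U₂) :
    finrank F (U₁ ⊓ U₂ : Submodule F W) < finrank F U₁ :=
  Submodule.finrank_lt_finrank_of_lt
    (lt_of_le_of_ne inf_le_left fun h => hV h₁ h₂ hne (inf_eq_left.1 h))

/-- An antichain of subspaces pairwise meeting in dimension less than `s` injects, up to double
counting, into the `s`-dimensional subspaces. -/
lemma card_le_card_grassmann_of_finrank_inf_lt (V : Finset (Submodule F W)) {s : ℕ}
    (hn : s ^ 2 ≤ finrank F W) (hV : IsAntichain (· ≤ ·) (V : Set (Submodule F W)))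
    (hL : ∀ U₁ ∈ V, ∀ U₂ ∈ V, U₁ ≠ U₂ → finrank F (U₁ ⊓ U₂ : Submodule F W) < s) :
    #V ≤ #(grassmann F W s) := by
  classical
  set q := Fintype.card F
  have hsn : s ≤ finrank F W := (Nat.le_self_pow two_ne_zero s).trans hn
  set A := V.filter fun U : Submodule F W => finrank F U < s with hA
  set B := V.filter fun U : Submodule F W => ¬ finrank F U < s with hB
  set SA := (grassmann F W s).filter fun T : Submodule F W => ∃ U ∈ A, U ≤ T with hSA
  set SB := (grassmann F W s).filter fun T : Submodule F W => ∃ U ∈ B, T ≤ U with hSB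
  have hdisj : Disjoint SA SB := by
    rw [disjoint_left]
    intro T hTA hTB
    obtain ⟨U₁, h₁, h₁T⟩ := (mem_filter.1 hTA).2
    obtain ⟨U₂, h₂, hT₂⟩ := (mem_filter.1 hTB).2
    obtain ⟨h₁V, h₁s⟩ := mem_filter.1 h₁
    obtain ⟨h₂V, h₂s⟩ := mem_filter.1 h₂
    exact hV h₁V h₂V (fun h => h₂s (h ▸ h₁s)) (h₁T.trans hT₂)
  -- Two members cannot share an `s`-dimensional subspace, so any choice of one inside each member
  -- is injective.
  have hBle : #B ≤ #SB := by
    have : ∀ U ∈ B, ∃ T ≤ U, finrank F T = s := fun U hU =>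
      exists_le_finrank_eq U (not_lt.1 (mem_filter.1 hU).2)
    choose! f hf using this
    refine card_le_card_of_injOn f (fun U hU => ?_) fun U₁ h₁ U₂ h₂ h => ?_
    · exact mem_filter.2 ⟨mem_grassmann.2 (hf U hU).2, U, hU, (hf U hU).1⟩
    · by_contra hne
      have h3 := hL U₁ (mem_filter.1 h₁).1 U₂ (mem_filter.1 h₂).1 hne
      have h4 : f U₁ ≤ U₁ ⊓ U₂ := le_inf (hf U₁ h₁).1 (h ▸ (hf U₂ h₂).1)
      have h5 := Submodule.finrank_mono h4
      rw [(hf U₁ h₁).2] at h5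
      omega
  -- Each member of `A` lies below at least `q ^ (n - s)` elements of `SA`, with `n = finrank F W`,
  -- and each of these contains at most `q ^ (s * (s - 1))` members; `s ^ 2 ≤ n` compares the
  -- exponents.
  have hAle : #A ≤ #SA := by
    have h := card_mul_le_card_mul (s := A) (t := SA) (fun U T : Submodule F W => U ≤ T)
      (m := q ^ (s * (s - 1))) (n := q ^ (s * (s - 1))) (fun U hU => ?_) (fun T hT => ?_)
    · exact Nat.le_of_mul_le_mul_right h (pow_pos Fintype.card_pos _)
    · refine le_trans (Nat.pow_le_pow_right Fintype.card_pos ?_)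
        (pow_le_card_grassmann_above U (mem_filter.1 hU).2 hsn _ fun T hUT hT => ?_)
      · rw [Nat.mul_sub, mul_one, ← pow_two]
        omega
      · exact mem_filter.2 ⟨mem_filter.2 ⟨mem_grassmann.2 hT, U, hU, hUT⟩, hUT⟩
    · have hT := mem_grassmann.1 (mem_filter.1 hT).1
      rw [← hT]
      refine card_subspaces_le_pow T _ _ fun U hU => ?_
      obtain ⟨hUA, hUT⟩ := mem_filter.1 hU
      have := (mem_filter.1 hUA).2
      exact ⟨hUT, by omega⟩
  calc #V = #A + #B := (card_filter_add_card_filter_not _).symm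
    _ ≤ #SA + #SB := add_le_add hAle hBle
    _ = #(SA ∪ SB) := (card_union_of_disjoint hdisj).symm
    _ ≤ _ := card_le_card (union_subset (filter_subset _ _) (filter_subset _ _))

/-- The Frankl–Wilson type bound for a family of subspaces which all contain `T`. -/
lemma card_le_sum_gaussBinom_of_forall_le (T : Submodule F W) (V : Finset (Submodule F W))
    (L : Finset ℕ) {m : ℕ} (hLm : #L ≤ m) (hm : m + finrank F T ≤ finrank F W)
    (hT : ∀ U ∈ V, T ≤ U) (hV : IsAntichain (· ≤ ·) (V : Set (Submodule F W)))
    (hL : ∀ U₁ ∈ V, ∀ U₂ ∈ V, U₁ ≠ U₂ → finrank F (U₁ ⊓ U₂ : Submodule F W) ∈ L) :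
    (#V : ℝ) ≤
      ∑ i ∈ range (m + 1), gaussBinom (Fintype.card F) (finrank F W - finrank F T) i := by
  classical
  obtain ⟨C, hC, V', hcard, hV', hL'⟩ := exists_family_in_complement T V L hT hV hL
  have h1 := card_le_card_grassmannLE V' _ hV' hL'
  have hC' : finrank F W - finrank F T = finrank F C := by omega
  rw [hC', ← card_grassmannLE (by omega), ← hcard]
  refine Nat.cast_le.2 (h1.trans (card_le_card fun X hX => ?_))
  have h2 := mem_grassmannLE.1 hX
  have h3 : #(L.image (· - finrank F T)) ≤ #L := card_image_le
  exact mem_grassmannLE.2 (by omega)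

lemma card_lt_gaussBinom_of_ne_range (V : Finset (Submodule F W)) (L : Finset ℕ) (h0 : 0 ∈ L)
    (hr : L ≠ range #L) (hn : 2 * #L + 1 ≤ finrank F W)
    (hV : IsAntichain (· ≤ ·) (V : Set (Submodule F W)))
    (hL : ∀ U₁ ∈ V, ∀ U₂ ∈ V, U₁ ≠ U₂ → finrank F (U₁ ⊓ U₂ : Submodule F W) ∈ L) :
    (#V : ℝ) < gaussBinom (Fintype.card F) (finrank F W) #L := by
  classical
  have := Fintype.ofFinite W
  obtain ⟨t, ht⟩ : ∃ t, #L = t + 1 := ⟨#L - 1, by have := card_pos.2 ⟨0, h0⟩; omega⟩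
  obtain ⟨n, hnW⟩ : ∃ n, finrank F W = n + 1 := ⟨finrank F W - 1, by omega⟩
  rw [ht] at hr hn
  rw [ht, hnW]
  rw [hnW] at hn
  set q : ℕ := Fintype.card F with hqdef
  have hq : (2 : ℝ) ≤ q := two_le_card_field
  set G := gaussBinom (q : ℝ) (n + 1) (t + 1) with hG
  have hGpos : 0 < G := gaussBinom_pos hq (by omega)
  set A := V.filter fun U : Submodule F W => finrank F U ≤ t + 1 with hA
  set B := V.filter fun U : Submodule F W => ¬ finrank F U ≤ t + 1 with hB
  have hsub : ∀ P : Submodule F W → Prop, ∀ _ : DecidablePred P,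
      IsAntichain (· ≤ ·) (V.filter P : Set (Submodule F W)) := fun P _ =>
    hV.subset (coe_subset.2 (filter_subset P V))
  -- Intersections within `A` have dimension below `t + 1 = #L`, and `L ≠ range #L` leaves at most
  -- `t` such values.
  have hAle : 3 * (#A : ℝ) ≤ G := by
    have h1 : (#A : ℝ) ≤ _ := card_le_sum_gaussBinom_of_forall_le (F := F) (W := W) ⊥ A
      (L.filter (· < t + 1)) (m := t) ?_ (by rw [finrank_bot]; omega) (fun _ _ => bot_le)
      (hsub _ _) ?_
    · rw [finrank_bot, hnW, Nat.sub_zero] at h1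
      have h2 := three_mul_sum_gaussBinom_le hq (n := n + 1) (s := t + 1) (by omega)
      linarith
    · by_contra! hcon
      have h2 : L.filter (· < t + 1) = L :=
        eq_of_subset_of_card_le (filter_subset _ _) (by omega)
      refine hr (eq_of_subset_of_card_le (fun l hl => ?_) (by simp [ht]))
      rw [← h2] at hl
      exact mem_range.2 (mem_filter.1 hl).2
    · intro U₁ h₁ U₂ h₂ hne
      obtain ⟨h₁V, h₁t⟩ := mem_filter.1 h₁
      have h₂V := (mem_filter.1 h₂).1
      have := finrank_inf_lt_of_antichain hV h₁V h₂V hne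
      exact mem_filter.2 ⟨hL U₁ h₁V U₂ h₂V hne, by omega⟩
  -- Members through `v` never meet in dimension `0`, so `L.erase 0` suffices. The factor `4/3` is
  -- the top term plus the third that bounds the lower ones.
  have hdeg : ∀ v : W, v ≠ 0 → 3 * (#(B.filter fun U : Submodule F W => v ∈ U) : ℝ) ≤ 4 * gaussBinom q n t := by
    intro v hv
    have hfv := finrank_span_singleton (K := F) hv
    have h1 : (#(B.filter fun U : Submodule F W => v ∈ U) : ℝ) ≤ _ := card_le_sum_gaussBinom_of_forall_le
      (Submodule.span F {v}) _ (L.erase 0) (m := t) (by rw [card_erase_of_mem h0]; omega)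
      (by rw [hfv]; omega) (fun U hU => ?_) ?_ ?_
    · rw [hfv, hnW, Nat.add_sub_cancel, sum_range_succ] at h1
      have h2 := three_mul_sum_gaussBinom_le hq (n := n) (s := t) (by omega)
      linarith
    · exact (Submodule.span_singleton_le_iff_mem _ _).2 (mem_filter.1 hU).2
    · exact hV.subset (coe_subset.2 ((filter_subset _ _).trans (filter_subset _ _)))
    · intro U₁ h₁ U₂ h₂ hne
      obtain ⟨h₁B, h₁v⟩ := mem_filter.1 h₁
      obtain ⟨h₂B, h₂v⟩ := mem_filter.1 h₂
      refine mem_erase.2 ⟨fun h => hv ?_, hL U₁ (mem_filter.1 h₁B).1 U₂ (mem_filter.1 h₂B).1 hne⟩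
      have h3 : v ∈ U₁ ⊓ U₂ := ⟨h₁v, h₂v⟩
      rwa [Submodule.finrank_eq_zero.1 h, Submodule.mem_bot] at h3
  have hcardU : ∀ U : Submodule F W, #(univ.filter fun v => v ∈ U) = q ^ finrank F U := by
    intro U
    rw [← Fintype.card_subtype, card_eq_pow_finrank (K := F)]
  -- Double count pairs of a nonzero vector and a member of `B` containing it; these members have
  -- dimension at least `t + 2`.
  have hcount : ((q : ℝ) ^ (t + 2) - 1) * (3 * #B) ≤ ((q : ℝ) ^ (n + 1) - 1) *
      (4 * gaussBinom q n t) := by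
    have h1 : ((q : ℝ) ^ (t + 2) - 1) * #B ≤
        ∑ v ∈ univ.erase (0 : W), (#(B.filter fun U : Submodule F W => v ∈ U) : ℝ) := by
      have h2 := sum_card_bipartiteAbove_eq_sum_card_bipartiteBelow (s := univ.erase (0 : W))
        (t := B) (fun v U => v ∈ U)
      have h3 := congrArg (Nat.cast (R := ℝ)) h2
      simp only [Nat.cast_sum, bipartiteAbove, bipartiteBelow] at h3
      rw [h3, mul_comm, ← nsmul_eq_mul]
      refine card_nsmul_le_sum _ _ _ fun U hU => ?_
      have hU := (mem_filter.1 hU).2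
      rw [filter_erase, card_erase_of_mem (by simp), hcardU, Nat.cast_sub
        (Nat.one_le_pow _ _ Fintype.card_pos), Nat.cast_pow, Nat.cast_one]
      have : (q : ℝ) ^ (t + 2) ≤ (q : ℝ) ^ finrank F U :=
        pow_le_pow_right₀ (by linarith) (by omega)
      linarith
    have h4 : ∑ v ∈ univ.erase (0 : W), 3 * (#(B.filter fun U : Submodule F W => v ∈ U) : ℝ) ≤
        #(univ.erase (0 : W)) • (4 * gaussBinom q n t) :=
      sum_le_card_nsmul _ _ _ fun v hv => hdeg v (ne_of_mem_erase hv)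
    rw [card_erase_of_mem (mem_univ _), card_univ, card_eq_pow_finrank (K := F), hnW, nsmul_eq_mul,
      Nat.cast_sub (Nat.one_le_pow _ _ Fintype.card_pos), Nat.cast_pow, Nat.cast_one,
      ← mul_sum] at h4
    linarith
  have hVAB : (#V : ℝ) = #A + #B := by
    exact_mod_cast (card_filter_add_card_filter_not (s := V) fun U => finrank F U ≤ t + 1).symm
  have hy : 0 < (q : ℝ) ^ (t + 1) - 1 := pow_sub_one_pos hq (by omega)
  have hG' : ((q : ℝ) ^ (n + 1) - 1) * gaussBinom q n t = ((q : ℝ) ^ (t + 1) - 1) * G := by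
    rw [hG, gaussBinom_succ_succ]
    field_simp
  have hq2 : 2 * ((q : ℝ) ^ (t + 1) - 1) + 1 ≤ (q : ℝ) ^ (t + 2) - 1 := by
    rw [pow_succ (q : ℝ) (t + 1)]
    nlinarith
  by_contra! hcon
  -- The count bounds `#B` by `4/3 * (q ^ (t + 1) - 1) / (q ^ (t + 2) - 1) * G`, which is strictly
  -- below `2/3 * G`.
  have hBge : 2 * G ≤ 3 * (#B : ℝ) := by linarith
  have h5 : (2 * ((q : ℝ) ^ (t + 1) - 1) + 1) * (2 * G) ≤
      ((q : ℝ) ^ (t + 2) - 1) * (3 * #B) :=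
    mul_le_mul hq2 hBge (by positivity) (by linarith)
  nlinarith

lemma card_le_gaussBinom_of_zero_mem (V : Finset (Submodule F W)) (L : Finset ℕ) (h0 : 0 ∈ L)
    (hn : 2 * #L + 1 ≤ finrank F W) (hn' : #L ^ 2 ≤ finrank F W)
    (hV : IsAntichain (· ≤ ·) (V : Set (Submodule F W)))
    (hL : ∀ U₁ ∈ V, ∀ U₂ ∈ V, U₁ ≠ U₂ → finrank F (U₁ ⊓ U₂ : Submodule F W) ∈ L) :
    (#V : ℝ) ≤ gaussBinom (Fintype.card F) (finrank F W) #L ∧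
      ((#V : ℝ) = gaussBinom (Fintype.card F) (finrank F W) #L → L = range #L) := by
  by_cases hr : L = range #L
  · refine ⟨?_, fun _ => hr⟩
    rw [← card_grassmann (by omega)]
    refine Nat.cast_le.2 (card_le_card_grassmann_of_finrank_inf_lt V hn' hV
      fun U₁ h₁ U₂ h₂ hne => ?_)
    have := hL U₁ h₁ U₂ h₂ hne
    rw [hr] at this
    exact mem_range.1 this
  · have := card_lt_gaussBinom_of_ne_range V L h0 hr hn hV hL
    exact ⟨this.le, fun h => absurd h this.ne⟩

-- Classify each member by a chosen `l`-dimensional subspace of its intersection with `M`; there are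
-- at most `q ^ (finrank M * l)` choices.
open Classical in
lemma card_le_mul_pow_of_le_finrank_inf (V : Finset (Submodule F W)) (M : Submodule F W) {l c : ℕ}
    (hM : ∀ U ∈ V, l ≤ finrank F (U ⊓ M : Submodule F W))
    (hc : ∀ T ≤ M, finrank F T = l → #(V.filter fun U : Submodule F W => T ≤ U) ≤ c) :
    #V ≤ c * Fintype.card F ^ (finrank F M * l) := by
  have : ∀ U ∈ V, ∃ T ≤ U ⊓ M, finrank F T = l := fun U hU => exists_le_finrank_eq _ (hM U hU)
  choose! f hf using this
  have h1 : #V ≤ c * #(V.image f) := by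
    refine card_le_mul_card_image _ _ fun T hT => ?_
    obtain ⟨U, hU, rfl⟩ := mem_image.1 hT
    refine le_trans (card_le_card fun U' hU' => ?_) (hc _ ((hf U hU).1.trans inf_le_right) (hf U hU).2)
    obtain ⟨hU'V, h⟩ := mem_filter.1 hU'
    exact mem_filter.2 ⟨hU'V, h ▸ ((hf U' hU'V).1.trans inf_le_left)⟩
  refine h1.trans (Nat.mul_le_mul_left _ (card_subspaces_le_pow M l _ fun T hT => ?_))
  obtain ⟨U, hU, rfl⟩ := mem_image.1 hT
  exact ⟨(hf U hU).1.trans inf_le_right, (hf U hU).2.le⟩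

/-- If no `l`-dimensional subspace lies in all members, where `l` bounds the intersection dimensions
from below, then every member contains one of few `(l + 1)`-dimensional subspaces. -/
lemma card_le_of_no_common_subspace (V : Finset (Submodule F W)) (L : Finset ℕ) {l k : ℕ}
    (hl : l ∈ L) (hk : ∀ U ∈ V, finrank F U ≤ k)
    (hpair : ∀ U₁ ∈ V, ∀ U₂ ∈ V, l ≤ finrank F (U₁ ⊓ U₂ : Submodule F W))
    (hno : ∀ T : Submodule F W, finrank F T = l → ∃ U ∈ V, ¬ T ≤ U)
    (hV : IsAntichain (· ≤ ·) (V : Set (Submodule F W)))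
    (hL : ∀ U₁ ∈ V, ∀ U₂ ∈ V, U₁ ≠ U₂ → finrank F (U₁ ⊓ U₂ : Submodule F W) ∈ L) :
    #V ≤ #(grassmannLE F W (#L - 1)) * Fintype.card F ^ (2 * l * k) := by
  classical
  obtain rfl | ⟨U₀, hU₀⟩ := V.eq_empty_or_nonempty
  · simp
  have hpow : ∀ U ∈ V, Fintype.card F ^ (finrank F U * l) ≤ Fintype.card F ^ (l * k) :=
    fun U hU => Nat.pow_le_pow_right Fintype.card_pos
      (by rw [mul_comm]; exact Nat.mul_le_mul_left _ (hk U hU))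
  rw [show 2 * l * k = l * k + l * k by ring, pow_add, ← mul_assoc]
  refine (card_le_mul_pow_of_le_finrank_inf V U₀ (fun U hU => hpair U hU U₀ hU₀)
    fun T₀ _ hT₀ => ?_).trans (Nat.mul_le_mul_left _ (hpow U₀ hU₀))
  obtain ⟨U', hU', hTU'⟩ := hno T₀ hT₀
  refine (card_le_mul_pow_of_le_finrank_inf _ U'
    (fun U hU => hpair U (mem_filter.1 hU).1 U' hU') fun T₁ hT hT₁ => ?_).trans
    (Nat.mul_le_mul_left _ (hpow U' hU'))
  rw [← card_erase_of_mem hl]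
  refine card_le_card_grassmannLE _ _
    (hV.subset (coe_subset.2 ((filter_subset _ _).trans (filter_subset _ _)))) ?_
  intro U₁ h₁ U₂ h₂ hne
  obtain ⟨h₁, h₁T₁⟩ := mem_filter.1 h₁
  obtain ⟨h₁, h₁T₀⟩ := mem_filter.1 h₁
  obtain ⟨h₂, h₂T₁⟩ := mem_filter.1 h₂
  obtain ⟨h₂, h₂T₀⟩ := mem_filter.1 h₂
  refine mem_erase.2 ⟨fun h => ?_, hL U₁ h₁ U₂ h₂ hne⟩
  -- `T₁` lies in `U'` and `T₀` does not, so members containing both meet in dimension greater than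
  -- `l`.
  have h3 : T₁ < T₀ ⊔ T₁ := lt_of_le_of_ne le_sup_right fun h =>
    hTU' ((le_sup_left.trans h.ge).trans hT)
  have h4 := Submodule.finrank_lt_finrank_of_lt h3
  have h5 : T₀ ⊔ T₁ ≤ U₁ ⊓ U₂ := sup_le (le_inf h₁T₀ h₂T₀) (le_inf h₁T₁ h₂T₁)
  have h6 := Submodule.finrank_mono h5
  omega

end IntersectingAntichains

/-! ### The case of positive minimal intersection dimension, and the combined bound. -/

section MainBound

set_option linter.unusedSectionVars false

open Finset Module

variable {F W : Type*} [Field F] [Fintype F] [AddCommGroup W] [Module F W] [Finite W]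

lemma card_lt_gaussBinom_of_pos (V : Finset (Submodule F W)) (L : Finset ℕ) {k l : ℕ}
    (hl0 : l ≠ 0) (hl : l ∈ L) (hmin : ∀ x ∈ L, l ≤ x) (hLk : ∀ x ∈ L, x < k)
    (hk : ∀ U ∈ V, finrank F U ≤ k) (hV2 : 1 < #V) (hn : 2 * #L + 1 ≤ finrank F W)
    (hn' : l + #L + (l + 1) * (k ^ 2 - (l + 1)) ≤ finrank F W)
    (hV : IsAntichain (· ≤ ·) (V : Set (Submodule F W)))
    (hL : ∀ U₁ ∈ V, ∀ U₂ ∈ V, U₁ ≠ U₂ → finrank F (U₁ ⊓ U₂ : Submodule F W) ∈ L) :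
    (#V : ℝ) < gaussBinom (Fintype.card F) (finrank F W) #L := by
  classical
  have hq : (2 : ℝ) ≤ Fintype.card F := two_le_card_field
  have hs0 : 0 < #L := card_pos.2 ⟨l, hl⟩
  have hs : #L ≤ k - l := by
    rw [← Nat.card_Ico]
    exact card_le_card fun x hx => mem_Ico.2 ⟨hmin x hx, hLk x hx⟩
  have hlk := hLk l hl
  obtain ⟨c, rfl⟩ : ∃ c, k = c + 1 := ⟨k - 1, by omega⟩
  have hlc : l ≤ c := by omega
  have hl1 : 1 ≤ l := Nat.one_le_iff_ne_zero.2 hl0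
  have hprod : (l + 1) * ((c + 1) * c) ≤ (l + 1) * ((c + 1) ^ 2 - (l + 1)) := by
    refine Nat.mul_le_mul_left _ ?_
    have : (c + 1) ^ 2 = (c + 1) * c + (c + 1) := by ring
    omega
  -- Only the lower bound `(l + 1) * (k * (k - 1)) ≤ P`, with `k = c + 1`, is needed from here on.
  generalize (l + 1) * ((c + 1) ^ 2 - (l + 1)) = P at hn' hprod
  have hpair : ∀ U₁ ∈ V, ∀ U₂ ∈ V, l ≤ finrank F (U₁ ⊓ U₂ : Submodule F W) := by
    intro U₁ h₁ U₂ h₂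
    by_cases h : U₁ = U₂
    · subst h
      obtain ⟨U, hU, hne⟩ := exists_mem_ne hV2 U₁
      refine (hmin _ (hL U₁ h₁ U hU hne.symm)).trans (Submodule.finrank_mono ?_)
      rw [inf_idem]
      exact inf_le_left
    · exact hmin _ (hL U₁ h₁ U₂ h₂ h)
  by_cases hcom : ∃ T : Submodule F W, finrank F T = l ∧ ∀ U ∈ V, T ≤ U
  · obtain ⟨T, hTl, hT⟩ := hcom
    obtain ⟨C, hC, V', hcard, hV', hL'⟩ := exists_family_in_complement T V L hT hV hL
    rw [hTl] at hL' hC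
    have hCdim : #L + 2 * ((c + 1) * c) ≤ finrank F C := by
      have : 2 * ((c + 1) * c) ≤ (l + 1) * ((c + 1) * c) := Nat.mul_le_mul_right _ (by omega)
      omega
    have hLc : #L ≤ c := by omega
    have hcardL : #(L.image (· - l)) = #L := by
      refine card_image_of_injOn fun x hx y hy h => ?_
      have h1 := hmin x hx
      have h2 := hmin y hy
      omega
    have h1 := (card_le_gaussBinom_of_zero_mem V' (L.image (· - l))
      (mem_image.2 ⟨l, hl, Nat.sub_self l⟩) ?_ ?_ hV' hL').1
    · rw [hcard, hcardL] at h1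
      refine h1.trans_lt (gaussBinom_lt_gaussBinom_of_lt_left hq hs0.ne' ?_ (by omega))
      omega
    · rw [hcardL]
      nlinarith
    · rw [hcardL]
      nlinarith
  · push Not at hcom
    have h1 := card_le_of_no_common_subspace V L hl hk hpair hcom hV hL
    obtain ⟨t, ht⟩ : ∃ t, #L = t + 1 := ⟨#L - 1, by omega⟩
    rw [ht, Nat.add_sub_cancel] at h1
    rw [ht] at hn hn' hs ⊢
    have h2 : (#V : ℝ) ≤ #(grassmannLE F W t) * (Fintype.card F : ℝ) ^ (2 * l * (c + 1)) := by
      exact_mod_cast h1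
    rw [card_grassmannLE (by omega), mul_comm] at h2
    refine h2.trans_lt (mul_sum_gaussBinom_lt hq (by omega) ?_)
    have h3 : l * c + 1 ≤ l * c ^ 2 + c ^ 2 := by nlinarith [Nat.mul_le_mul_left l hlc]
    have h4 : t + l ≤ c := by omega
    nlinarith

lemma card_le_gaussBinom_of_min_mem (V : Finset (Submodule F W)) (L : Finset ℕ) {k l : ℕ}
    (hl : l ∈ L) (hmin : ∀ x ∈ L, l ≤ x) (hLk : ∀ x ∈ L, x < k)
    (hk : ∀ U ∈ V, finrank F U ≤ k) (hV2 : 1 < #V) (hn : 2 * #L + 1 ≤ finrank F W)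
    (hn' : l + #L + (l + 1) * (k ^ 2 - (l + 1)) ≤ finrank F W)
    (hV : IsAntichain (· ≤ ·) (V : Set (Submodule F W)))
    (hL : ∀ U₁ ∈ V, ∀ U₂ ∈ V, U₁ ≠ U₂ → finrank F (U₁ ⊓ U₂ : Submodule F W) ∈ L) :
    (#V : ℝ) ≤ gaussBinom (Fintype.card F) (finrank F W) #L ∧
      ((#V : ℝ) = gaussBinom (Fintype.card F) (finrank F W) #L → L = range #L) := by
  obtain rfl | hl0 := eq_or_ne l 0
  · refine card_le_gaussBinom_of_zero_mem V L hl hn ?_ hV hL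
    have h1 : #L ≤ k := by
      rw [← card_range k]
      exact card_le_card fun x hx => mem_range.2 (hLk x hx)
    have h2 := Nat.pow_le_pow_left h1 2
    have h3 : 0 < #L := card_pos.2 ⟨0, hl⟩
    omega
  · have h := card_lt_gaussBinom_of_pos V L hl0 hl hmin hLk hk hV2 hn hn' hV hL
    exact ⟨h.le, fun h' => absurd h' h.ne⟩

end MainBound

theorem theorem1p16 {F W : Type*} [Field F] [Fintype F] [AddCommGroup W] [Module F W]
    [FiniteDimensional F W] (n q s : ℕ)
    (hq : Fintype.card F = q) (hn : Module.finrank F W = n)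
    (L : Finset ℕ) (hL : L.Nonempty) (hs : L.card = s)
    (V : Finset (Submodule F W))
    (hSperner : IsAntichain (· ≤ ·) (V : Set (Submodule F W)))
    (hInter : ∀ U₁ ∈ V, ∀ U₂ ∈ V, U₁ ≠ U₂ →
      Module.finrank F (U₁ ⊓ U₂ : Submodule F W) ∈ L)
    (hbound : (n : ℝ) ≥
      max (Real.logb q
            (((q : ℝ) ^ s - 1) * gaussBinom q (maxDim V ^ 2) (L.min' hL + 1) + 1) + (L.min' hL : ℝ))
          (2 * (s : ℝ) + 1)) :
    (V.card : ℝ) ≤ gaussBinom q n s ∧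
      ((V.card : ℝ) = gaussBinom q n s → L = Finset.range s) := by
  have : Finite W := Module.finite_of_finite F
  obtain ⟨hlog, hns⟩ := max_le_iff.1 hbound
  have hns : 2 * s + 1 ≤ n := by exact_mod_cast hns
  have hs0 : 0 < s := hs ▸ Finset.card_pos.2 hL
  subst hq hn
  have hq2 : (2 : ℝ) ≤ Fintype.card F := two_le_card_field
  -- With at most one member both claims follow from `1 = [n, 0] < [n, s]`.
  rcases le_or_gt V.card 1 with hV1 | hV2
  · have h1 : (V.card : ℝ) ≤ 1 := by exact_mod_cast hV1
    have h2 := gaussBinom_lt_gaussBinom_of_lt_right hq2 hs0 hns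
    rw [gaussBinom_zero_right] at h2
    exact ⟨by linarith, fun h => by linarith⟩
  set k := maxDim V with hkdef
  have hk : ∀ U ∈ V, Module.finrank F U ≤ k := fun U hU =>
    Finset.le_sup (f := fun U : Submodule F W => Module.finrank F U) hU
  -- Distinct members meet in dimension below `k`, so larger elements of `L` can be dropped; if any
  -- are, `[n, #L'] < [n, s]` makes the bound strict.
  set L' := L.filter (· < k) with hL'def
  have hInter' : ∀ U₁ ∈ V, ∀ U₂ ∈ V, U₁ ≠ U₂ →
      Module.finrank F (U₁ ⊓ U₂ : Submodule F W) ∈ L' := fun U₁ h₁ U₂ h₂ hne =>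
    Finset.mem_filter.2 ⟨hInter U₁ h₁ U₂ h₂ hne,
      (finrank_inf_lt_of_antichain hSperner h₁ h₂ hne).trans_le (hk U₁ h₁)⟩
  set l := L.min' hL with hldef
  have hlk : l < k := by
    obtain ⟨U₁, h₁, U₂, h₂, hne⟩ := Finset.one_lt_card.1 hV2
    have h := Finset.mem_filter.1 (hInter' U₁ h₁ U₂ h₂ hne)
    exact (L.min'_le _ h.1).trans_lt h.2
  have hl : l ∈ L' := Finset.mem_filter.2 ⟨L.min'_mem hL, hlk⟩
  have hn' := le_of_logb_gaussBinom_le hq2 hs0.ne' (l := l) (m := k ^ 2)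
    (hlk.trans_le (Nat.le_self_pow two_ne_zero k)) hlog
  have hs' : L'.card ≤ s := hs ▸ Finset.card_le_card (Finset.filter_subset _ _)
  have key := card_le_gaussBinom_of_min_mem V L' hl
    (fun x hx => L.min'_le x (Finset.mem_filter.1 hx).1) (fun x hx => (Finset.mem_filter.1 hx).2)
    hk hV2 (by omega) (by omega) hSperner hInter'
  rcases hs'.lt_or_eq with hlt | heq
  · have h := key.1.trans_lt (gaussBinom_lt_gaussBinom_of_lt_right hq2 hlt hns)
    exact ⟨h.le, fun h' => absurd h' h.ne⟩
  · have hLL : L' = L :=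
      Finset.eq_of_subset_of_card_le (Finset.filter_subset _ _) (by rw [heq, hs])
    rwa [hLL, hs] at key
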